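/- Let $M$ be a connected (Hausdorff, second countable) smooth manifold of finite dimension without boundary, let $h$ be a smooth Riemannian metric on $M$ and let $\omega$ be a smooth $1$-form on $M$ with $|\omega(v)|<\sqrt{h(v,v)}$ for every nonzero tangent vector $v$. Let $R(v)=\sqrt{h(v,v)}+\omega(v)$ be the associated Randers metric. For $F=R$ or $F=\sqrt h$, let $d_F(p,q)=\inf_\gamma\int_a^bF(\dot\gamma(t))\,dt$, where the infimum is over all piecewise smooth curves $\gamma:[a,b]\to M$ from $p$ to $q$. Write $d_h=d_{\sqrt h}$ for the Riemannian distance, and let $d_s(p,q)=\tfrac12\bigl(d_R(p,q)+d_R(q,p)\bigr)$ be the symmetrized distance of $d_R$. For a curve $\alpha:[a,b]\to M$ and $t_0\in[a,b]$ let $$\mathrm{dil}_{t_0}(\alpha)=\lim_{\varepsilon\to0^+}\ \sup\Bigl\{\frac{d_s(\alpha(s),\alpha(t))}{|s-t|}\ :\ s,t\in[a,b]\cap(t_0-\varepsilon,t_0+\varepsilon),\ s\neq t\Bigr\}$$ (with $\sup\emptyset=0$), and $l(\alpha)=\int_a^b\mathrm{dil}_t(\alpha)\,dt$. Let $d_s^l(p,q)=\inf_\alpha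 l(\alpha)$, where the infimum is over all piecewise smooth curves $\alpha$ from $p$ to $q$, be the length distance associated to $d_s$. Then $d_s^l(p,q)=d_h(p,q)$ for all $p,q\in M$. -/

import Mathlib

open Set MeasureTheory Filter Topology Bundle
open scoped Manifold ContDiff ENNReal

noncomputable section

section Curves

variable {E : Type*} [NormedAddCommGroup E] [NormedSpace ℝ E]
  {M : Type*} [TopologicalSpace M] [ChartedSpace E M]

/-- The curve `γ|[a,b]` is piecewise smooth: `[a,b]` is cut by a finite partition
`a = t 0 ≤ t 1 ≤ … ≤ t n = b` into closed intervals on each of which `γ` is `C^∞` up to the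
endpoints (in particular `γ` is continuous on `[a,b]`). Values of `γ` off `[a,b]` are irrelevant. -/
def PiecewiseSmoothOn (E : Type*) [NormedAddCommGroup E] [NormedSpace ℝ E]
    {M : Type*} [TopologicalSpace M] [ChartedSpace E M] (γ : ℝ → M) (a b : ℝ) : Prop :=
  ∃ (n : ℕ) (t : ℕ → ℝ), Monotone t ∧ t 0 = a ∧ t n = b ∧
    ∀ i < n, ContMDiffOn 𝓘(ℝ, ℝ) 𝓘(ℝ, E) ∞ γ (Icc (t i) (t (i + 1)))

/-- `γ`, on the parameter interval `[a,b]`, is a piecewise smooth curve from `p` to `q`. -/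
structure IsCurveFromTo (E : Type*) [NormedAddCommGroup E] [NormedSpace ℝ E]
    {M : Type*} [TopologicalSpace M] [ChartedSpace E M]
    (γ : ℝ → M) (a b : ℝ) (p q : M) : Prop where
  lt : a < b
  smooth : PiecewiseSmoothOn E γ a b
  source : γ a = p
  target : γ b = q

/-- The length `∫_a^b F(γ'(t)) dt` for a nonnegative function `F` on tangent vectors, as an element
of `[0,∞]`. At the finitely many break points of a piecewise smooth curve the velocity may fail to
exist; these do not contribute to the integral. -/
def finslerLength (F : ∀ x : M, TangentSpace 𝓘(ℝ, E) x → ℝ) (γ : ℝ → M) (a b : ℝ) : ℝ≥0∞ :=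
  ∫⁻ t in Icc a b, ENNReal.ofReal (F (γ t) (mfderiv 𝓘(ℝ, ℝ) 𝓘(ℝ, E) γ t (1 : ℝ)))

/-- The (in general non-symmetric) distance of `F`: the infimum of the `F`-lengths of piecewise
smooth curves from `p` to `q`. -/
def finslerDist (F : ∀ x : M, TangentSpace 𝓘(ℝ, E) x → ℝ) (p q : M) : ℝ≥0∞ :=
  ⨅ (γ : ℝ → M) (a : ℝ) (b : ℝ) (_ : IsCurveFromTo E γ a b p q), finslerLength F γ a b

end Curves

section LengthMetric

variable {M : Type*}

/-- The symmetrization `(d(p,q) + d(q,p)) / 2` of a generalized distance. -/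
def symmetrizedDist (d : M → M → ℝ≥0∞) (p q : M) : ℝ≥0∞ :=
  (d p q + d q p) / 2

/-- The dilatation `sup_{s ≠ t ∈ S} d(α(s),α(t)) / |s - t|` of the restriction of `α` to `S`. -/
def dilatation (d : M → M → ℝ≥0∞) (α : ℝ → M) (S : Set ℝ) : ℝ≥0∞ :=
  ⨆ (s ∈ S) (t ∈ S) (_ : s ≠ t), d (α s) (α t) / ENNReal.ofReal |s - t|

/-- The local dilatation at `t₀` of the curve `α : S → M`: the limit, as `ε → 0⁺`, of the
dilatation of `α` on `S ∩ (t₀ - ε, t₀ + ε)`. Since that quantity is nondecreasing in `ε`, the limit is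
the infimum; see `tendsto_dilatation_localDilatation`. -/
def localDilatation (d : M → M → ℝ≥0∞) (α : ℝ → M) (S : Set ℝ) (t₀ : ℝ) : ℝ≥0∞ :=
  ⨅ (ε : ℝ) (_ : 0 < ε), dilatation d α (S ∩ Ioo (t₀ - ε) (t₀ + ε))

theorem dilatation_mono (d : M → M → ℝ≥0∞) (α : ℝ → M) {S T : Set ℝ} (h : S ⊆ T) :
    dilatation d α S ≤ dilatation d α T := by
  unfold dilatation
  refine iSup₂_le fun s hs => iSup₂_le fun t ht => iSup_le fun hst => ?_
  exact le_iSup₂_of_le s (h hs) (le_iSup₂_of_le t (h ht) (le_iSup_of_le hst le_rfl))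

theorem tendsto_dilatation_localDilatation (d : M → M → ℝ≥0∞) (α : ℝ → M) (S : Set ℝ) (t₀ : ℝ) :
    Tendsto (fun ε : ℝ => dilatation d α (S ∩ Ioo (t₀ - ε) (t₀ + ε))) (𝓝[>] 0)
      (𝓝 (localDilatation d α S t₀)) := by
  have hm : Monotone fun ε : ℝ => dilatation d α (S ∩ Ioo (t₀ - ε) (t₀ + ε)) := fun x y hxy =>
    dilatation_mono d α
      (inter_subset_inter_right S (Ioo_subset_Ioo (by linarith) (by linarith)))
  have h := hm.tendsto_nhdsGT 0
  rwa [sInf_image] at h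

/-- The length `∫_a^b dil_t(α) dt` of a curve `α : [a,b] → M` with respect to `d`. -/
def dilatationLength (d : M → M → ℝ≥0∞) (α : ℝ → M) (a b : ℝ) : ℝ≥0∞ :=
  ∫⁻ t in Icc a b, localDilatation d α (Icc a b) t

/-- The length distance associated with `d`: the infimum of the lengths with respect to `d` of the
piecewise smooth curves from `p` to `q`. -/
def lengthDist (E : Type*) [NormedAddCommGroup E] [NormedSpace ℝ E]
    [TopologicalSpace M] [ChartedSpace E M] (d : M → M → ℝ≥0∞) (p q : M) : ℝ≥0∞ :=
  ⨅ (α : ℝ → M) (a : ℝ) (b : ℝ) (_ : IsCurveFromTo E α a b p q), dilatationLength d α a b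

end LengthMetric

section Randers

variable {E : Type*} [NormedAddCommGroup E] [NormedSpace ℝ E]
  {M : Type*} [TopologicalSpace M] [ChartedSpace E M] [IsManifold 𝓘(ℝ, E) ∞ M]

/-- The norm `v ↦ √(h(v,v))` of a smooth Riemannian metric `h`. -/
def riemannianNorm
    (h : ContMDiffRiemannianMetric 𝓘(ℝ, E) ∞ E (fun x : M => TangentSpace 𝓘(ℝ, E) x))
    (x : M) (v : TangentSpace 𝓘(ℝ, E) x) : ℝ :=
  √(h.inner x v v)

/-- The function `v ↦ √(h(v,v)) + θ(v)`. -/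
def randersNorm
    (h : ContMDiffRiemannianMetric 𝓘(ℝ, E) ∞ E (fun x : M => TangentSpace 𝓘(ℝ, E) x))
    (θ : ∀ x : M, TangentSpace 𝓘(ℝ, E) x →L[ℝ] ℝ)
    (x : M) (v : TangentSpace 𝓘(ℝ, E) x) : ℝ :=
  √(h.inner x v v) + θ x v

/-- `θ` is a smooth `1`-form with `|θ(v)| < √(h(v,v))` for every nonzero tangent vector `v`, so
that `√h + θ` is a Randers metric. -/
structure IsRandersForm
    (h : ContMDiffRiemannianMetric 𝓘(ℝ, E) ∞ E (fun x : M => TangentSpace 𝓘(ℝ, E) x))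
    (θ : ∀ x : M, TangentSpace 𝓘(ℝ, E) x →L[ℝ] ℝ) : Prop where
  contMDiff : ContMDiff 𝓘(ℝ, E) (𝓘(ℝ, E).prod 𝓘(ℝ, E →L[ℝ] ℝ)) ∞
    (fun x : M => TotalSpace.mk' (E →L[ℝ] ℝ)
      (E := fun x : M => TangentSpace 𝓘(ℝ, E) x →L[ℝ] ℝ) x (θ x))
  abs_lt : ∀ (x : M) (v : TangentSpace 𝓘(ℝ, E) x), v ≠ 0 → |θ x v| < √(h.inner x v v)

theorem randersNorm_pos
    {h : ContMDiffRiemannianMetric 𝓘(ℝ, E) ∞ E (fun x : M => TangentSpace 𝓘(ℝ, E) x)}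
    {θ : ∀ x : M, TangentSpace 𝓘(ℝ, E) x →L[ℝ] ℝ} (hθ : IsRandersForm h θ)
    (x : M) (v : TangentSpace 𝓘(ℝ, E) x) (hv : v ≠ 0) : 0 < randersNorm h θ x v := by
  have h1 := (_root_.abs_lt.mp (hθ.abs_lt x v hv)).1
  unfold randersNorm
  linarith

end Randers

end

/-!
Let `R = √h + θ` be a Randers norm. The two infima in the statement run over the same curves, so it
suffices that every piecewise smooth curve `γ` has the same length for both sides, and for this that
the local dilatation of `γ` with respect to the symmetrized distance `d_s` of `R` is `√h(γ'(t))` at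
every `t` other than the finitely many break points.

At such a `t`, with velocity `v`, the distances satisfy
`d_R(γ(t), γ(u)) / (u - t) → R(v)` and `d_R(γ(u), γ(t)) / (u - t) → R(-v)` as `u → t⁺`, and averaging
cancels the `1`-form: `(R(v) + R(-v)) / 2 = √h(v)`. Since `d_R(q, p)` is the distance from `p` to `q`
for the reverse norm `v ↦ R(-v)` (`finslerDist_reverseNorm`), which is again a Randers norm, only
forward distances have to be estimated, for a general Finsler function `F`.

* Upper bound (`exists_finslerDist_le`): the distance between two points of `γ` is at most the length
  of the arc of `γ` between them, and `F ∘ γ'` is continuous at `t`.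
* Lower bound (`IsFinslerFunction.eventually_le_finslerDist`): let `l` be a linear functional with
  `l ≤ F` on the tangent space and `l(v) = F(v)`; for a Randers norm, Cauchy–Schwarz gives
  `l = h(v, ·) / √h(v, v) + θ`. For `k < 1`, the functional `k l`, read in the chart at `γ(t)`, is a
  function whose differential stays below `F` near `γ(t)`, by compactness of the unit sphere. A curve
  from `γ(t)` to `γ(u)` inside a small chart ball is therefore at least as long as the increment of
  this function, which is `k F(v) (u - t) + o(u - t)`; a curve that leaves the ball has length bounded
  below by a positive constant (`IsFinslerFunction.exists_min_le_finslerDist`).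

Both bounds are combined in `localDilatation_symmetrizedDist`.
-/

/-! ### Finsler functions -/

theorem continuous_snd_of_continuous_trivial {M X : Type*} [TopologicalSpace M]
    [TopologicalSpace X] {b : X → M} {f : X → ℝ}
    (hf : Continuous fun w => TotalSpace.mk' ℝ (E := Bundle.Trivial M ℝ) (b w) (f w)) :
    Continuous f :=
  continuous_snd.comp ((Bundle.Trivial.homeomorphProd M ℝ).continuous.comp hf)

section Finsler

variable {E : Type*} [NormedAddCommGroup E] [NormedSpace ℝ E]
  {M : Type*} [TopologicalSpace M] [ChartedSpace E M] [IsManifold 𝓘(ℝ, E) ∞ M]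

/-- A continuous, not necessarily reversible Finsler function. Convexity on the tangent spaces is
encoded by the existence of a supporting linear functional at every vector. -/
structure IsFinslerFunction (F : ∀ x : M, TangentSpace 𝓘(ℝ, E) x → ℝ) : Prop where
  continuous : Continuous fun w : TangentBundle 𝓘(ℝ, E) M => F w.1 w.2
  apply_smul : ∀ (x : M) (c : ℝ) (v : TangentSpace 𝓘(ℝ, E) x), 0 ≤ c → F x (c • v) = c * F x v
  pos : ∀ (x : M) (v : TangentSpace 𝓘(ℝ, E) x), v ≠ 0 → 0 < F x v
  exists_support : ∀ (x : M) (v : TangentSpace 𝓘(ℝ, E) x),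
    ∃ l : TangentSpace 𝓘(ℝ, E) x →L[ℝ] ℝ, (∀ w, l w ≤ F x w) ∧ l v = F x v

/-- The reverse `v ↦ F (-v)` of a function on tangent vectors. -/
noncomputable def reverseNorm (F : ∀ x : M, TangentSpace 𝓘(ℝ, E) x → ℝ) (x : M)
    (v : TangentSpace 𝓘(ℝ, E) x) : ℝ :=
  F x (-v)

namespace IsFinslerFunction

variable {F : ∀ x : M, TangentSpace 𝓘(ℝ, E) x → ℝ}

theorem apply_zero (hF : IsFinslerFunction F) (x : M) : F x 0 = 0 := by
  simpa using hF.apply_smul x 0 0 le_rfl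

theorem nonneg (hF : IsFinslerFunction F) (x : M) (v : TangentSpace 𝓘(ℝ, E) x) : 0 ≤ F x v := by
  rcases eq_or_ne v 0 with rfl | hv
  · exact (hF.apply_zero x).ge
  · exact (hF.pos x v hv).le

end IsFinslerFunction

/-- Cauchy–Schwarz inequality for a Riemannian metric. -/
theorem abs_inner_le_riemannianNorm
    (h : ContMDiffRiemannianMetric 𝓘(ℝ, E) ∞ E (fun x : M => TangentSpace 𝓘(ℝ, E) x))
    (x : M) (v w : TangentSpace 𝓘(ℝ, E) x) :
    |h.inner x v w| ≤ riemannianNorm h x v * riemannianNorm h x w := by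
  have hnn : ∀ u, 0 ≤ h.inner x u u := fun u => by
    rcases eq_or_ne u 0 with rfl | hu
    · simp
    · exact (h.pos x u hu).le
  have hquad : ∀ t : ℝ, 0 ≤ h.inner x w w * (t * t) + 2 * h.inner x v w * t + h.inner x v v := by
    intro t
    have := hnn (v + t • w)
    simp only [map_add, map_smul, _root_.add_apply, smul_eq_mul,
      FunLike.coe_smul, Pi.smul_apply, h.symm x w v] at this
    linarith
  have hd := discrim_le_zero hquad
  unfold riemannianNorm
  rw [← Real.sqrt_mul (hnn v)]
  apply Real.abs_le_sqrt
  unfold discrim at hd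
  linarith

theorem continuous_riemannianNorm
    (h : ContMDiffRiemannianMetric 𝓘(ℝ, E) ∞ E (fun x : M => TangentSpace 𝓘(ℝ, E) x)) :
    Continuous fun w : TangentBundle 𝓘(ℝ, E) M => riemannianNorm h w.1 w.2 := by
  have h1 : ContMDiff 𝓘(ℝ, E).tangent 𝓘(ℝ, E) ∞ fun w : TangentBundle 𝓘(ℝ, E) M => w.1 :=
    contMDiff_proj (TangentSpace 𝓘(ℝ, E))
  have h2 := ContMDiff.clm_bundle_apply₂ (F₁ := E) (E₁ := fun x : M => TangentSpace 𝓘(ℝ, E) x)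
    (F₂ := E) (E₂ := fun x : M => TangentSpace 𝓘(ℝ, E) x)
    (F₃ := ℝ) (E₃ := Bundle.Trivial M ℝ) (h.contMDiff.comp h1)
    (v := fun w : TangentBundle 𝓘(ℝ, E) M => w.2) (w := fun w : TangentBundle 𝓘(ℝ, E) M => w.2)
    contMDiff_id contMDiff_id
  exact (continuous_snd_of_continuous_trivial h2.continuous).sqrt

theorem IsRandersForm.continuous
    {h : ContMDiffRiemannianMetric 𝓘(ℝ, E) ∞ E (fun x : M => TangentSpace 𝓘(ℝ, E) x)}
    {θ : ∀ x : M, TangentSpace 𝓘(ℝ, E) x →L[ℝ] ℝ} (hθ : IsRandersForm h θ) :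
    Continuous fun w : TangentBundle 𝓘(ℝ, E) M => θ w.1 w.2 := by
  have h1 : ContMDiff 𝓘(ℝ, E).tangent 𝓘(ℝ, E) ∞ fun w : TangentBundle 𝓘(ℝ, E) M => w.1 :=
    contMDiff_proj (TangentSpace 𝓘(ℝ, E))
  have h2 := ContMDiff.clm_bundle_apply (F₁ := E) (E₁ := fun x : M => TangentSpace 𝓘(ℝ, E) x)
    (F₂ := ℝ) (E₂ := Bundle.Trivial M ℝ) (hθ.contMDiff.comp h1)
    (v := fun w : TangentBundle 𝓘(ℝ, E) M => w.2) contMDiff_id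
  exact continuous_snd_of_continuous_trivial h2.continuous

/-- The sum of a Riemannian norm and a strictly dominated continuous covector field is a Finsler
function. The supporting functional at `v` is `h(v, ·) / √h(v, v) + θ`. -/
theorem isFinslerFunction_randersNorm
    {h : ContMDiffRiemannianMetric 𝓘(ℝ, E) ∞ E (fun x : M => TangentSpace 𝓘(ℝ, E) x)}
    {θ : ∀ x : M, TangentSpace 𝓘(ℝ, E) x →L[ℝ] ℝ}
    (hc : Continuous fun w : TangentBundle 𝓘(ℝ, E) M => θ w.1 w.2)
    (hlt : ∀ (x : M) (v : TangentSpace 𝓘(ℝ, E) x), v ≠ 0 → |θ x v| < √(h.inner x v v)) :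
    IsFinslerFunction (randersNorm h θ) where
  continuous := (continuous_riemannianNorm h).add hc
  apply_smul x c v hc := by
    simp only [randersNorm, map_smul, FunLike.coe_smul, Pi.smul_apply, smul_eq_mul]
    rw [← mul_assoc, Real.sqrt_mul (mul_self_nonneg c), Real.sqrt_mul_self hc]
    ring
  pos x v hv := by
    have := neg_lt_of_abs_lt (hlt x v hv)
    unfold randersNorm
    linarith
  exists_support x v := by
    -- At `v = 0` the inverse is zero, and the functional is `θ x`.
    refine ⟨(√(h.inner x v v))⁻¹ • h.inner x v + θ x, fun w => ?_, ?_⟩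
    · simp only [randersNorm, _root_.add_apply, FunLike.coe_smul,
        Pi.smul_apply, smul_eq_mul, add_le_add_iff_right]
      have h1 := (le_abs_self _).trans (abs_inner_le_riemannianNorm h x v w)
      simp only [riemannianNorm] at h1
      rcases (Real.sqrt_nonneg (h.inner x v v)).eq_or_lt with h0 | h0
      · rw [← h0]
        simp
      · rwa [inv_mul_le_iff₀ h0]
    · simp only [randersNorm, _root_.add_apply, FunLike.coe_smul,
        Pi.smul_apply, smul_eq_mul, add_left_inj]
      rw [inv_mul_eq_div, Real.div_sqrt]

theorem reverseNorm_randersNorm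
    (h : ContMDiffRiemannianMetric 𝓘(ℝ, E) ∞ E (fun x : M => TangentSpace 𝓘(ℝ, E) x))
    (θ : ∀ x : M, TangentSpace 𝓘(ℝ, E) x →L[ℝ] ℝ) :
    reverseNorm (randersNorm h θ) = randersNorm h (fun x => -θ x) := by
  funext x v
  simp [reverseNorm, randersNorm]

theorem IsRandersForm.isFinslerFunction
    {h : ContMDiffRiemannianMetric 𝓘(ℝ, E) ∞ E (fun x : M => TangentSpace 𝓘(ℝ, E) x)}
    {θ : ∀ x : M, TangentSpace 𝓘(ℝ, E) x →L[ℝ] ℝ} (hθ : IsRandersForm h θ) :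
    IsFinslerFunction (randersNorm h θ) :=
  isFinslerFunction_randersNorm hθ.continuous hθ.abs_lt

theorem IsRandersForm.isFinslerFunction_reverseNorm
    {h : ContMDiffRiemannianMetric 𝓘(ℝ, E) ∞ E (fun x : M => TangentSpace 𝓘(ℝ, E) x)}
    {θ : ∀ x : M, TangentSpace 𝓘(ℝ, E) x →L[ℝ] ℝ} (hθ : IsRandersForm h θ) :
    IsFinslerFunction (reverseNorm (randersNorm h θ)) := by
  rw [reverseNorm_randersNorm]
  refine isFinslerFunction_randersNorm hθ.continuous.neg fun x v hv => ?_
  simpa using hθ.abs_lt x v hv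

end Finsler

/-! ### Reversal of curves -/

section Reverse

variable {E : Type*} [NormedAddCommGroup E] [NormedSpace ℝ E]
  {M : Type*} [TopologicalSpace M] [ChartedSpace E M]

theorem PiecewiseSmoothOn.comp_neg {γ : ℝ → M} {a b : ℝ} (hγ : PiecewiseSmoothOn E γ a b) :
    PiecewiseSmoothOn E (fun t => γ (-t)) (-b) (-a) := by
  obtain ⟨n, t, ht, h0, hn, hs⟩ := hγ
  refine ⟨n, fun i => -t (n - i), fun i j hij => neg_le_neg (ht (by omega)), by simp [hn],
    by simp [h0], fun i hi => ?_⟩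
  have h1 := hs (n - (i + 1)) (by omega)
  rw [show n - (i + 1) + 1 = n - i by omega] at h1
  refine h1.comp (contDiff_neg.contMDiff.contMDiffOn) fun s hs => ?_
  exact ⟨by linarith [hs.2], by linarith [hs.1]⟩

/-- No differentiability is needed: where `γ` is not differentiable, both sides are zero. -/
theorem mfderiv_comp_neg (γ : ℝ → M) (t : ℝ) :
    mfderiv 𝓘(ℝ, ℝ) 𝓘(ℝ, E) (fun s => γ (-s)) t (1 : ℝ) =
      -mfderiv 𝓘(ℝ, ℝ) 𝓘(ℝ, E) γ (-t) (1 : ℝ) := by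
  have hneg : ∀ s : ℝ, HasMFDerivAt 𝓘(ℝ, ℝ) 𝓘(ℝ, ℝ) (fun s : ℝ => -s) s
      (-ContinuousLinearMap.id ℝ ℝ) := fun s => (hasFDerivAt_id s).neg.hasMFDerivAt
  by_cases hd : MDifferentiableAt 𝓘(ℝ, ℝ) 𝓘(ℝ, E) γ (-t)
  · have := (hd.hasMFDerivAt.comp t (hneg t)).mfderiv
    have h2 := congr($this (1 : ℝ))
    refine h2.trans ?_
    exact map_neg (mfderiv 𝓘(ℝ, ℝ) 𝓘(ℝ, E) γ (-t)) (1 : ℝ)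
  · have hd' : ¬ MDifferentiableAt 𝓘(ℝ, ℝ) 𝓘(ℝ, E) (fun s => γ (-s)) t := by
      intro hd'
      rw [show t = - -t by simp] at hd'
      have := hd'.comp (-t) (hneg (-t)).mdifferentiableAt
      simp only [Function.comp_def, neg_neg] at this
      exact hd this
    rw [mfderiv_zero_of_not_mdifferentiableAt hd, mfderiv_zero_of_not_mdifferentiableAt hd']
    exact neg_zero.symm

theorem finslerLength_comp_neg (F : ∀ x : M, TangentSpace 𝓘(ℝ, E) x → ℝ) (γ : ℝ → M) (a b : ℝ) :
    finslerLength (reverseNorm F) (fun t => γ (-t)) (-b) (-a) = finslerLength F γ a b := by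
  unfold finslerLength reverseNorm
  have := (Measure.measurePreserving_neg (volume : Measure ℝ)).setLIntegral_comp_preimage_emb
    (Homeomorph.neg ℝ).measurableEmbedding
    (fun t => ENNReal.ofReal (F (γ t) (mfderiv 𝓘(ℝ, ℝ) 𝓘(ℝ, E) γ t (1 : ℝ)))) (Icc a b)
  rw [← this, neg_preimage, neg_Icc]
  refine lintegral_congr fun t => ?_
  rw [mfderiv_comp_neg, neg_neg]

theorem finslerDist_reverseNorm_le (F : ∀ x : M, TangentSpace 𝓘(ℝ, E) x → ℝ) (p q : M) :
    finslerDist (reverseNorm F) p q ≤ finslerDist F q p := by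
  refine le_iInf fun γ => le_iInf fun a => le_iInf fun b => le_iInf fun hγ => ?_
  rw [← finslerLength_comp_neg]
  exact iInf_le_of_le (fun t => γ (-t)) <| iInf_le_of_le (-b) <| iInf_le_of_le (-a) <|
    iInf_le_of_le ⟨neg_lt_neg hγ.lt, hγ.smooth.comp_neg, by simpa using hγ.target,
      by simpa using hγ.source⟩ le_rfl

theorem finslerDist_reverseNorm (F : ∀ x : M, TangentSpace 𝓘(ℝ, E) x → ℝ) (p q : M) :
    finslerDist (reverseNorm F) p q = finslerDist F q p := by
  refine le_antisymm (finslerDist_reverseNorm_le F p q) ?_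
  have hF : reverseNorm (reverseNorm F) = F := by
    funext x v
    simp [reverseNorm]
  simpa [hF] using finslerDist_reverseNorm_le (reverseNorm F) q p

end Reverse

/-! ### Comparison with linear functionals in a chart -/

section Comparison

variable {E : Type*} [NormedAddCommGroup E] [NormedSpace ℝ E] [FiniteDimensional ℝ E]
  {M : Type*} [TopologicalSpace M] [ChartedSpace E M] [IsManifold 𝓘(ℝ, E) ∞ M]
  {F : ∀ x : M, TangentSpace 𝓘(ℝ, E) x → ℝ}

/-- A strict inequality `N < F` on `T_x M`, where `N` is a positively homogeneous function on the
model space, transported by the chart at `x`, persists near `x`. By homogeneity it suffices to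
look at the unit sphere of the model space, which is compact. -/
theorem IsFinslerFunction.eventually_le (hF : IsFinslerFunction F) (x : M) {N : E → ℝ}
    (hN : Continuous N) (hNs : ∀ (c : ℝ) (u : E), 0 ≤ c → N (c • u) = c * N u)
    (hlt : ∀ w : TangentSpace 𝓘(ℝ, E) x, w ≠ 0 →
      N ((trivializationAt E (TangentSpace 𝓘(ℝ, E)) x).continuousLinearMapAt ℝ x w) < F x w) :
    ∀ᶠ y in 𝓝 x, ∀ w : TangentSpace 𝓘(ℝ, E) y,
      N ((trivializationAt E (TangentSpace 𝓘(ℝ, E)) x).continuousLinearMapAt ℝ y w) ≤ F y w := by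
  set e := trivializationAt E (TangentSpace 𝓘(ℝ, E) : M → Type _) x with he
  have hx : x ∈ e.baseSet := FiberBundle.mem_baseSet_trivializationAt' x
  have hsphere : ∀ᶠ y in 𝓝 x, ∀ u ∈ Metric.sphere (0 : E) 1, N u < F y (e.symm y u) := by
    refine (isCompact_sphere (0 : E) 1).eventually_forall_of_forall_eventually fun u hu => ?_
    have hmem : (x, u) ∈ e.baseSet ×ˢ (univ : Set E) := ⟨hx, mem_univ u⟩
    have hopen : IsOpen (e.baseSet ×ˢ (univ : Set E)) := e.open_baseSet.prod isOpen_univ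
    have hc : ContinuousAt (fun z : M × E =>
        F (TotalSpace.mk' E z.1 (e.symm z.1 z.2)).1 (TotalSpace.mk' E z.1 (e.symm z.1 z.2)).2)
        (x, u) :=
      hF.continuous.continuousAt.comp (e.continuousOn_symm.continuousAt (hopen.mem_nhds hmem))
    refine (hN.continuousAt.comp continuousAt_snd).eventually_lt hc ?_
    have hne : e.symmL ℝ x u ≠ 0 := by
      intro h0
      have h1 := e.continuousLinearMapAt_symmL (R := ℝ) hx u
      rw [h0, map_zero] at h1
      rw [← h1] at hu
      simp at hu
    have h2 := hlt _ hne
    rw [e.continuousLinearMapAt_symmL hx] at h2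
    rwa [e.symmL_apply hx] at h2
  filter_upwards [hsphere, e.open_baseSet.mem_nhds hx] with y hy hyb w
  set u := e.continuousLinearMapAt ℝ y w with hu
  have hw : w = e.symmL ℝ y u := (e.symmL_continuousLinearMapAt hyb w).symm
  rcases eq_or_ne u 0 with h0 | h0
  · rw [hw, h0, map_zero, hF.apply_zero]
    have := hNs 0 0 le_rfl
    simp only [zero_smul, zero_mul] at this
    exact this.le
  · have hn : 0 < ‖u‖ := norm_pos_iff.mpr h0
    have h3 := (hy (‖u‖⁻¹ • u) (by simp [norm_smul, hn.ne'])).le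
    rw [← e.symmL_apply (R := ℝ) hyb, map_smul, ← hw, hNs _ _ (by positivity),
      hF.apply_smul _ _ _ (by positivity)] at h3
    exact le_of_mul_le_mul_left h3 (by positivity)

/-- Near `x`, a Finsler function dominates a multiple of the norm of the model space. -/
theorem IsFinslerFunction.exists_eventually_norm_le (hF : IsFinslerFunction F) (x : M) :
    ∃ c > 0, ∀ᶠ y in 𝓝 x, ∀ w : TangentSpace 𝓘(ℝ, E) y,
      c * ‖(trivializationAt E (TangentSpace 𝓘(ℝ, E)) x).continuousLinearMapAt ℝ y w‖ ≤ F y w := by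
  set e := trivializationAt E (TangentSpace 𝓘(ℝ, E) : M → Type _) x with he
  have hx : x ∈ e.baseSet := FiberBundle.mem_baseSet_trivializationAt' x
  have hcont : Continuous fun u : E => F x (e.symmL ℝ x u) := by
    have h1 : Continuous fun u : E => (TotalSpace.mk' E x (e.symmL ℝ x u) :
        TangentBundle 𝓘(ℝ, E) M) :=
      (FiberBundle.continuous_totalSpaceMk E (TangentSpace 𝓘(ℝ, E)) x).comp (e.symmL ℝ x).continuous
    exact hF.continuous.comp h1
  have hne : ∀ u : E, u ≠ 0 → e.symmL ℝ x u ≠ 0 := fun u hu h0 => hu <| by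
    rw [← e.continuousLinearMapAt_symmL (R := ℝ) hx u, h0, map_zero]
  obtain ⟨c, hc, hle⟩ : ∃ c > 0, ∀ u ∈ Metric.sphere (0 : E) 1, c < F x (e.symmL ℝ x u) := by
    rcases (Metric.sphere (0 : E) 1).eq_empty_or_nonempty with h0 | h0
    · exact ⟨1, one_pos, by simp [h0]⟩
    · obtain ⟨u₀, hu₀, hmin⟩ := (isCompact_sphere (0 : E) 1).exists_isMinOn h0 hcont.continuousOn
      have hpos : 0 < F x (e.symmL ℝ x u₀) :=
        hF.pos x _ (hne _ (ne_zero_of_mem_unit_sphere ⟨u₀, hu₀⟩))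
      exact ⟨_, half_pos hpos, fun u hu => (half_lt_self hpos).trans_le (hmin hu)⟩
  refine ⟨c, hc, hF.eventually_le x (N := fun u => c * ‖u‖) (by fun_prop)
    (fun r u hr => by rw [norm_smul, Real.norm_of_nonneg hr]; ring) fun w hw => ?_⟩
  set u := e.continuousLinearMapAt ℝ x w with hu
  have hwu : w = e.symmL ℝ x u := (e.symmL_continuousLinearMapAt hx w).symm
  have hu0 : u ≠ 0 := by
    intro h0
    rw [h0, map_zero] at hwu
    exact hw hwu
  have hn : 0 < ‖u‖ := norm_pos_iff.mpr hu0
  have h3 := hle (‖u‖⁻¹ • u) (by simp [norm_smul, hn.ne'])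
  rwa [map_smul, ← hwu, hF.apply_smul _ _ _ (by positivity), ← div_eq_inv_mul, lt_div_iff₀ hn] at h3

end Comparison

/-! ### Increments of a function along a curve -/

section Increments

variable {E : Type*} [NormedAddCommGroup E] [NormedSpace ℝ E]
  {M : Type*} [TopologicalSpace M] [ChartedSpace E M]

theorem finslerLength_add (F : ∀ x : M, TangentSpace 𝓘(ℝ, E) x → ℝ) (γ : ℝ → M) {a b c : ℝ}
    (hab : a ≤ b) (hbc : b ≤ c) :
    finslerLength F γ a b + finslerLength F γ b c = finslerLength F γ a c := by
  unfold finslerLength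
  rw [← Icc_union_Ioc_eq_Icc hab hbc, lintegral_union measurableSet_Ioc]
  · rw [restrict_Ioc_eq_restrict_Icc]
  · exact disjoint_left.mpr fun t ht ht' => ht.2.not_gt ht'.1

theorem ofReal_intervalIntegral_le_lintegral {a b : ℝ} (hab : a ≤ b) {g : ℝ → ℝ}
    (hg : IntervalIntegrable g volume a b) :
    ENNReal.ofReal (∫ t in a..b, g t) ≤ ∫⁻ t in Ioo a b, ENNReal.ofReal (g t) := by
  rw [intervalIntegral.integral_of_le hab, restrict_Ioo_eq_restrict_Ioc]
  have hi : IntegrableOn g (Ioc a b) := (intervalIntegrable_iff_integrableOn_Ioc_of_le hab).mp hg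
  have h1 : ∫ t in Ioc a b, g t ≤ ∫ t in Ioc a b, max (g t) 0 :=
    integral_mono hi hi.pos_part fun t => le_max_left _ _
  refine (ENNReal.ofReal_le_ofReal h1).trans ?_
  rw [ofReal_integral_eq_lintegral_ofReal hi.pos_part (ae_of_all _ fun t => le_max_right _ _)]
  exact lintegral_mono fun t => by simp

theorem hasDerivAt_comp_of_mdifferentiableAt {f : M → ℝ} {γ : ℝ → M} {t : ℝ}
    (hf : MDifferentiableAt 𝓘(ℝ, E) 𝓘(ℝ, ℝ) f (γ t))
    (hγ : MDifferentiableAt 𝓘(ℝ, ℝ) 𝓘(ℝ, E) γ t) :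
    HasDerivAt (f ∘ γ)
      (mvfderiv 𝓘(ℝ, E) f (γ t) (mfderiv 𝓘(ℝ, ℝ) 𝓘(ℝ, E) γ t (1 : ℝ))) t := by
  have h1 : deriv (f ∘ γ) t =
      mvfderiv 𝓘(ℝ, E) f (γ t) (mfderiv 𝓘(ℝ, ℝ) 𝓘(ℝ, E) γ t (1 : ℝ)) := by
    rw [← fderiv_apply_one_eq_deriv, ← mfderiv_eq_fderiv, mfderiv_comp t hf hγ]
    rfl
  rw [← h1]
  exact (hf.comp t hγ).differentiableAt.hasDerivAt

theorem ofReal_sub_le_finslerLength_of_contMDiffOn {F : ∀ x : M, TangentSpace 𝓘(ℝ, E) x → ℝ}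
    {f : M → ℝ} {U : Set M} (hU : IsOpen U) (hf : ContMDiffOn 𝓘(ℝ, E) 𝓘(ℝ, ℝ) 1 f U)
    (hfF : ∀ y ∈ U, ∀ w : TangentSpace 𝓘(ℝ, E) y, mvfderiv 𝓘(ℝ, E) f y w ≤ F y w)
    {γ : ℝ → M} {a b : ℝ} (hab : a ≤ b) (hγ : ContMDiffOn 𝓘(ℝ, ℝ) 𝓘(ℝ, E) 1 γ (Icc a b))
    (hγU : MapsTo γ (Icc a b) U) :
    ENNReal.ofReal (f (γ b) - f (γ a)) ≤ finslerLength F γ a b := by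
  have hg : ContDiffOn ℝ 1 (f ∘ γ) (Icc a b) := contMDiffOn_iff_contDiffOn.mp (hf.comp hγ hγU)
  rcases hab.eq_or_lt with rfl | hlt
  · simp
  have hint : IntervalIntegrable (derivWithin (f ∘ γ) (Icc a b)) volume a b := by
    apply ContinuousOn.intervalIntegrable
    rw [uIcc_of_le hab]
    exact hg.continuousOn_derivWithin (uniqueDiffOn_Icc hlt) le_rfl
  have h1 : f (γ b) - f (γ a) = ∫ t in a..b, derivWithin (f ∘ γ) (Icc a b) t :=
    (intervalIntegral.integral_derivWithin_Icc_of_contDiffOn_Icc hg hab).symm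
  rw [h1]
  refine (ofReal_intervalIntegral_le_lintegral hab hint).trans ?_
  unfold finslerLength
  rw [← restrict_Ioo_eq_restrict_Icc]
  refine setLIntegral_mono' measurableSet_Ioo fun t ht => ENNReal.ofReal_le_ofReal ?_
  have htn : Icc a b ∈ 𝓝 t := Icc_mem_nhds ht.1 ht.2
  have htU : γ t ∈ U := hγU (Ioo_subset_Icc_self ht)
  have hd1 : MDifferentiableAt 𝓘(ℝ, E) 𝓘(ℝ, ℝ) f (γ t) :=
    (hf.contMDiffAt (hU.mem_nhds htU)).mdifferentiableAt one_ne_zero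
  have hd2 : MDifferentiableAt 𝓘(ℝ, ℝ) 𝓘(ℝ, E) γ t :=
    (hγ.contMDiffAt htn).mdifferentiableAt one_ne_zero
  rw [derivWithin_of_mem_nhds htn, (hasDerivAt_comp_of_mdifferentiableAt hd1 hd2).deriv]
  exact hfF _ htU _

/-- If `df ≤ F` on an open set `U`, then along a curve which stays in `U` the increment of `f` is at
most the `F`-length. The curve is an initial part of a piecewise smooth curve. -/
theorem ofReal_sub_le_finslerLength {F : ∀ x : M, TangentSpace 𝓘(ℝ, E) x → ℝ}
    {f : M → ℝ} {U : Set M} (hU : IsOpen U) (hf : ContMDiffOn 𝓘(ℝ, E) 𝓘(ℝ, ℝ) 1 f U)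
    (hfF : ∀ y ∈ U, ∀ w : TangentSpace 𝓘(ℝ, E) y, mvfderiv 𝓘(ℝ, E) f y w ≤ F y w)
    {γ : ℝ → M} {a b : ℝ} (hγ : PiecewiseSmoothOn E γ a b) {τ : ℝ} (haτ : a ≤ τ) (hτb : τ ≤ b)
    (hγU : MapsTo γ (Icc a τ) U) :
    ENNReal.ofReal (f (γ τ) - f (γ a)) ≤ finslerLength F γ a τ := by
  obtain ⟨n, t, ht, rfl, rfl, hs⟩ := hγ
  suffices H : ∀ k ≤ n, ∀ τ, t 0 ≤ τ → τ ≤ t k → MapsTo γ (Icc (t 0) τ) U →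
      ENNReal.ofReal (f (γ τ) - f (γ (t 0))) ≤ finslerLength F γ (t 0) τ from
    H n le_rfl τ haτ hτb hγU
  intro k
  induction k with
  | zero =>
    intro _ τ h0 h1 _
    simp [le_antisymm h1 h0]
  | succ k ih =>
    intro hk τ h0 h1 hmaps
    rcases le_total τ (t k) with h2 | h2
    · exact ih (by omega) τ h0 h2 hmaps
    have h3 : t 0 ≤ t k := ht (Nat.zero_le k)
    rw [← finslerLength_add F γ h3 h2, ← sub_add_sub_cancel' (f (γ (t k)))]
    refine ENNReal.ofReal_add_le.trans (add_le_add ?_ ?_)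
    · exact ih (by omega) (t k) h3 le_rfl (hmaps.mono_left (Icc_subset_Icc_right h2))
    · refine ofReal_sub_le_finslerLength_of_contMDiffOn hU hf hfF h2
        (((hs k (by omega)).mono (Icc_subset_Icc_right h1)).of_le ?_)
        (hmaps.mono_left (Icc_subset_Icc_left h3))
      exact_mod_cast le_top

end Increments

/-! ### Lower bounds for the distance -/

section LowerBound

variable {E : Type*} [NormedAddCommGroup E] [NormedSpace ℝ E]
  {M : Type*} [TopologicalSpace M] [ChartedSpace E M]

theorem PiecewiseSmoothOn.continuousOn {γ : ℝ → M} {a b : ℝ} (hγ : PiecewiseSmoothOn E γ a b) :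
    ContinuousOn γ (Icc a b) := by
  obtain ⟨n, t, ht, rfl, rfl, hs⟩ := hγ
  suffices H : ∀ k ≤ n, ContinuousOn γ (Icc (t 0) (t k)) from H n le_rfl
  intro k
  induction k with
  | zero => simp
  | succ k ih =>
    intro hk
    rw [← Icc_union_Icc_eq_Icc (ht (Nat.zero_le k)) (ht (Nat.le_succ k))]
    exact (ih (by omega)).union_of_isClosed (hs k (by omega)).continuousOn isClosed_Icc isClosed_Icc

theorem mvfderiv_comp_extChartAt [IsManifold 𝓘(ℝ, E) ∞ M] (L : E →L[ℝ] ℝ) (x : M) {y : M}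
    (hy : y ∈ (chartAt E x).source) (w : TangentSpace 𝓘(ℝ, E) y) :
    mvfderiv 𝓘(ℝ, E) (fun z => L (extChartAt 𝓘(ℝ, E) x z)) y w =
      L ((trivializationAt E (TangentSpace 𝓘(ℝ, E)) x).continuousLinearMapAt ℝ y w) := by
  rw [TangentBundle.continuousLinearMapAt_trivializationAt hy]
  have h1 : MDifferentiableAt 𝓘(ℝ, E) 𝓘(ℝ, E) (extChartAt 𝓘(ℝ, E) x) y :=
    mdifferentiableAt_extChartAt hy
  have h2 := (L.hasMFDerivAt (x := extChartAt 𝓘(ℝ, E) x y)).comp y h1.hasMFDerivAt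
  exact congr($(h2.mfderiv) w)

variable [IsManifold 𝓘(ℝ, E) ∞ M] [FiniteDimensional ℝ E] [T2Space M]
  {F : ∀ x : M, TangentSpace 𝓘(ℝ, E) x → ℝ}

/-- If a linear functional of the chart at `x` has differential `< F` at `x`, then its increments
from `x` bound the distance from `x` from below, up to a cut-off: a curve which stays in a small
chart ball is as long as the increment of the functional, and a curve which leaves the ball has
length bounded from below. -/
theorem IsFinslerFunction.exists_min_le_finslerDist (hF : IsFinslerFunction F) (x : M)
    (L : E →L[ℝ] ℝ) (hL : ∀ w : TangentSpace 𝓘(ℝ, E) x, w ≠ 0 →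
      L ((trivializationAt E (TangentSpace 𝓘(ℝ, E)) x).continuousLinearMapAt ℝ x w) < F x w) :
    ∃ δ > 0, ∀ y, min (ENNReal.ofReal δ) (ENNReal.ofReal
      (L (extChartAt 𝓘(ℝ, E) x y) - L (extChartAt 𝓘(ℝ, E) x x))) ≤ finslerDist F x y := by
  set φ := extChartAt 𝓘(ℝ, E) x with hφ
  obtain ⟨c, hc, hnorm⟩ := hF.exists_eventually_norm_le x
  have hlin := hF.eventually_le x L.continuous (fun c u _ => by simp) hL
  obtain ⟨U, hU, hUo, hxU⟩ :=
    eventually_nhds_iff.mp ((hnorm.and hlin).and (chart_source_mem_nhds E x))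
  have hUs : U ⊆ (chartAt E x).source := fun y hy => (hU y hy).2
  have hincr : ∀ L' : E →L[ℝ] ℝ, (∀ y ∈ U, ∀ w : TangentSpace 𝓘(ℝ, E) y,
      L' ((trivializationAt E (TangentSpace 𝓘(ℝ, E)) x).continuousLinearMapAt ℝ y w) ≤ F y w) →
      ∀ (γ : ℝ → M) (a b τ : ℝ), PiecewiseSmoothOn E γ a b → a ≤ τ → τ ≤ b →
        MapsTo γ (Icc a τ) U →
        ENNReal.ofReal (L' (φ (γ τ)) - L' (φ (γ a))) ≤ finslerLength F γ a b := by
    intro L' hL' γ a b τ hγ haτ hτb hmaps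
    refine (ofReal_sub_le_finslerLength (f := fun z => L' (φ z)) hUo ?_ ?_ hγ haτ hτb
      hmaps).trans ((le_add_right le_rfl).trans (finslerLength_add F γ haτ hτb).le)
    · exact (L'.contMDiff.comp_contMDiffOn contMDiffOn_extChartAt).mono hUs
    · intro y hy w
      rw [mvfderiv_comp_extChartAt L' x (hUs hy)]
      exact hL' y hy w
  obtain ⟨r, hr, hball⟩ : ∃ r > 0, Metric.closedBall (φ x) r ⊆ φ.target ∩ φ.symm ⁻¹' U :=
    Metric.nhds_basis_closedBall.mem_iff.mp
      (Filter.inter_mem (extChartAt_target_mem_nhds x)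
        (extChartAt_preimage_mem_nhds (hUo.mem_nhds hxU)))
  set K := φ.symm '' Metric.closedBall (φ x) r with hK
  have hKU : K ⊆ U := by
    rintro _ ⟨z, hz, rfl⟩
    exact (hball hz).2
  have hKc : IsClosed K := ((isCompact_closedBall (φ x) r).image_of_continuousOn
    ((continuousOn_extChartAt_symm x).mono fun z hz => (hball hz).1)).isClosed
  set V := φ.source ∩ φ ⁻¹' Metric.ball (φ x) r with hV
  have hVo : IsOpen V := isOpen_extChartAt_preimage' x Metric.isOpen_ball
  have hVK : V ⊆ K := fun y hy => ⟨φ y, Metric.ball_subset_closedBall hy.2, φ.left_inv hy.1⟩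
  have hxV : x ∈ V := ⟨mem_extChartAt_source x, Metric.mem_ball_self hr⟩
  refine ⟨c * r, mul_pos hc hr, fun y => le_iInf fun γ => le_iInf fun a => le_iInf fun b =>
    le_iInf fun hγ => ?_⟩
  have hcont := hγ.smooth.continuousOn
  by_cases hstay : MapsTo γ (Icc a b) V
  · refine (min_le_right _ _).trans ?_
    have := hincr L (fun y hy => (hU y hy).1.2) γ a b b hγ.smooth hγ.lt.le le_rfl
      (hstay.mono_right (hVK.trans hKU))
    rwa [hγ.source, hγ.target] at this
  · refine (min_le_left _ _).trans ?_
    -- `τ` is the first exit time from `V`; up to and including `τ` the curve lies in `K`.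
    obtain ⟨τ, ⟨⟨haτ, hτb⟩, hτV⟩, hmin⟩ : ∃ τ, IsLeast (Icc a b ∩ γ ⁻¹' Vᶜ) τ := by
      have hcl : IsClosed (Icc a b ∩ γ ⁻¹' Vᶜ) :=
        hcont.preimage_isClosed_of_isClosed isClosed_Icc hVo.isClosed_compl
      refine (isCompact_Icc.of_isClosed_subset hcl inter_subset_left).exists_isLeast ?_
      simp only [MapsTo, not_forall] at hstay
      obtain ⟨t, ht, htV⟩ := hstay
      exact ⟨t, ht, htV⟩
    have hlt : ∀ t ∈ Ico a τ, γ t ∈ V := fun t ht => by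
      by_contra htV
      exact (hmin ⟨⟨ht.1, ht.2.le.trans hτb⟩, htV⟩).not_gt ht.2
    have haτ' : a < τ := by
      refine haτ.lt_of_ne fun h0 => hτV ?_
      rwa [← h0, hγ.source]
    have hτK : γ τ ∈ K := by
      have h1 : ContinuousWithinAt γ (Ico a τ) τ :=
        (hcont τ ⟨haτ, hτb⟩).mono fun t ht => ⟨ht.1, ht.2.le.trans hτb⟩
      have h2 : τ ∈ closure (Ico a τ) := by
        rw [closure_Ico haτ'.ne]
        exact right_mem_Icc.mpr haτ
      exact hKc.closure_subset_iff.mpr (fun z hz => hz)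
        (h1.mem_closure h2 fun t ht => hVK (hlt t ht))
    have hmaps : MapsTo γ (Icc a τ) U := fun t ht => by
      rcases ht.2.eq_or_lt with rfl | h0
      · exact hKU hτK
      · exact hKU (hVK (hlt t ⟨ht.1, h0⟩))
    have hfar : r ≤ ‖φ (γ τ) - φ x‖ := by
      by_contra! h0
      refine hτV ⟨?_, ?_⟩
      · rw [hφ, extChartAt_source]
        exact hUs (hKU hτK)
      · rwa [mem_preimage, Metric.mem_ball, dist_eq_norm]
    obtain ⟨g, hg, hgv⟩ := exists_dual_vector'' ℝ (φ (γ τ) - φ x)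
    refine le_trans (ENNReal.ofReal_le_ofReal ?_) (hincr (c • g) (fun y hy w => ?_) γ a b τ
      hγ.smooth haτ hτb hmaps)
    · rw [hγ.source, ← map_sub, FunLike.coe_smul, Pi.smul_apply, hgv, smul_eq_mul]
      exact mul_le_mul_of_nonneg_left hfar hc.le
    · refine le_trans ?_ ((hU y hy).1.1 w)
      rw [FunLike.coe_smul, Pi.smul_apply, smul_eq_mul]
      refine mul_le_mul_of_nonneg_left ?_ hc.le
      exact (le_abs_self _).trans ((g.le_of_opNorm_le hg _).trans_eq (one_mul _))

/-- The distance from `γ t` grows along `γ` at least at the rate `F (γ' t)`. -/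
theorem IsFinslerFunction.eventually_le_finslerDist (hF : IsFinslerFunction F) {γ : ℝ → M} {t : ℝ}
    (hγ : MDifferentiableAt 𝓘(ℝ, ℝ) 𝓘(ℝ, E) γ t) {c : ℝ}
    (hc : c < F (γ t) (mfderiv 𝓘(ℝ, ℝ) 𝓘(ℝ, E) γ t (1 : ℝ))) :
    ∀ᶠ u in 𝓝[>] t, ENNReal.ofReal (c * (u - t)) ≤ finslerDist F (γ t) (γ u) := by
  set x := γ t with hx
  set v := mfderiv 𝓘(ℝ, ℝ) 𝓘(ℝ, E) γ t (1 : ℝ) with hv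
  rcases le_or_gt c 0 with hc0 | hc0
  · filter_upwards [self_mem_nhdsWithin] with u hu
    rw [ENNReal.ofReal_of_nonpos (mul_nonpos_of_nonpos_of_nonneg hc0 (sub_pos.mpr hu).le)]
    exact zero_le
  obtain ⟨l, hl, hlv⟩ := hF.exists_support x v
  obtain ⟨k, hk, hk1⟩ := exists_between ((div_lt_one (hc0.trans hc)).mpr hc)
  have hk0 : 0 < k := (div_pos hc0 (hc0.trans hc)).trans hk
  rw [div_lt_iff₀ (hc0.trans hc)] at hk
  set e := trivializationAt E (TangentSpace 𝓘(ℝ, E) : M → Type _) x with he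
  have hxe : x ∈ e.baseSet := FiberBundle.mem_baseSet_trivializationAt' x
  -- The factor `k < 1` makes the differential of the functional strictly smaller than `F`.
  set L : E →L[ℝ] ℝ := k • l.comp (e.symmL ℝ x) with hLdef
  have hL : ∀ w : TangentSpace 𝓘(ℝ, E) x, L (e.continuousLinearMapAt ℝ x w) = k * l w :=
    fun w => congrArg (fun z => k * l z) (e.symmL_continuousLinearMapAt hxe w)
  obtain ⟨δ, hδ, hdist⟩ := hF.exists_min_le_finslerDist x L fun w hw => by
    rw [hL]
    nlinarith [hl w, hF.pos x w hw]
  have hderiv := hasDerivAt_comp_of_mdifferentiableAt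
    (f := fun z => L (extChartAt 𝓘(ℝ, E) x z)) (γ := γ) (t := t)
    ((L.contMDiff.contMDiffAt.comp _ (contMDiffAt_extChartAt (n := 1))).mdifferentiableAt
      one_ne_zero) hγ
  rw [mvfderiv_comp_extChartAt L x (mem_chart_source E x), hL, hlv] at hderiv
  have hslope : ∀ᶠ u in 𝓝[>] t, c < slope (_ ∘ γ) t u :=
    ((hasDerivAt_iff_tendsto_slope.mp hderiv).mono_left
      (nhdsWithin_mono t fun u hu => ne_of_gt hu)).eventually_const_lt hk
  have hsmall : ∀ᶠ u in 𝓝[>] t, c * (u - t) < δ := by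
    have h1 : ContinuousAt (fun u => c * (u - t)) t := by fun_prop
    exact nhdsWithin_le_nhds (h1.eventually_lt continuousAt_const (by simpa using hδ))
  filter_upwards [hslope, hsmall, self_mem_nhdsWithin] with u hu1 hu2 hu3
  refine le_trans (le_min (ENNReal.ofReal_le_ofReal hu2.le) (ENNReal.ofReal_le_ofReal ?_))
    (hdist (γ u))
  rw [slope_def_field, lt_div_iff₀ (sub_pos.mpr hu3)] at hu1
  exact hu1.le

end LowerBound

/-! ### The local dilatation of a smooth curve -/

section Dilatation

variable {E : Type*} [NormedAddCommGroup E] [NormedSpace ℝ E]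
  {M : Type*} [TopologicalSpace M] [ChartedSpace E M] [IsManifold 𝓘(ℝ, E) ∞ M]
  {F : ∀ x : M, TangentSpace 𝓘(ℝ, E) x → ℝ}

theorem continuousOn_apply_mfderiv
    (hF : Continuous fun w : TangentBundle 𝓘(ℝ, E) M => F w.1 w.2) {γ : ℝ → M} {s : Set ℝ}
    (hs : IsOpen s) (hγ : ContMDiffOn 𝓘(ℝ, ℝ) 𝓘(ℝ, E) 1 γ s) :
    ContinuousOn (fun t => F (γ t) (mfderiv 𝓘(ℝ, ℝ) 𝓘(ℝ, E) γ t (1 : ℝ))) s := by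
  have h1 := hγ.continuousOn_tangentMapWithin le_rfl hs.uniqueMDiffOn
  have h2 : Continuous fun t : ℝ => (⟨t, (1 : ℝ)⟩ : TangentBundle 𝓘(ℝ, ℝ) ℝ) :=
    (tangentBundleModelSpaceHomeomorph 𝓘(ℝ, ℝ)).symm.continuous.comp
      (continuous_id.prodMk continuous_const)
  refine (hF.comp_continuousOn (h1.comp h2.continuousOn fun t ht => ht)).congr fun t ht => ?_
  simp only [Function.comp_apply, tangentMapWithin]
  rw [mfderivWithin_of_isOpen hs ht]

/-- Along `γ` and near `t`, the distance grows at most at the rate `F (γ' t)`. -/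
theorem exists_finslerDist_le (hF : Continuous fun w : TangentBundle 𝓘(ℝ, E) M => F w.1 w.2)
    {γ : ℝ → M} {a b t : ℝ} (hγ : ContMDiffOn 𝓘(ℝ, ℝ) 𝓘(ℝ, E) ∞ γ (Icc a b)) (ht : t ∈ Ioo a b)
    {c : ℝ} (hc : F (γ t) (mfderiv 𝓘(ℝ, ℝ) 𝓘(ℝ, E) γ t (1 : ℝ)) < c) :
    ∃ ε > 0, ∀ s ∈ Ioo (t - ε) (t + ε), ∀ u ∈ Ioo (t - ε) (t + ε), s < u →
      finslerDist F (γ s) (γ u) ≤ ENNReal.ofReal c * ENNReal.ofReal (u - s) := by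
  have hcont := continuousOn_apply_mfderiv hF isOpen_Ioo
    ((hγ.mono Ioo_subset_Icc_self).of_le (by exact_mod_cast le_top))
  have hev : ∀ᶠ s in 𝓝 t, s ∈ Ioo a b ∧ F (γ s) (mfderiv 𝓘(ℝ, ℝ) 𝓘(ℝ, E) γ s (1 : ℝ)) < c :=
    (Ioo_mem_nhds ht.1 ht.2 |> eventually_mem_set.mpr).and
      ((hcont.continuousAt (isOpen_Ioo.mem_nhds ht)).eventually_lt_const hc)
  obtain ⟨ε, hε, hball⟩ := Metric.eventually_nhds_iff_ball.mp hev
  rw [Real.ball_eq_Ioo] at hball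
  refine ⟨ε, hε, fun s hs u hu hsu => ?_⟩
  have hsub : ∀ r ∈ Icc s u, r ∈ Ioo (t - ε) (t + ε) := fun r hr =>
    ⟨hs.1.trans_le hr.1, hr.2.trans_lt hu.2⟩
  have hcurve : IsCurveFromTo E γ s u (γ s) (γ u) := by
    refine ⟨hsu, ⟨1, fun i => if i = 0 then s else u, fun i j hij => ?_, by simp, by simp,
      fun i hi => ?_⟩, rfl, rfl⟩
    · rcases Nat.eq_zero_or_pos i with rfl | hi
      · by_cases hj : j = 0 <;> simp [hj, hsu.le]
      · simp [hi.ne', (hi.trans_le hij).ne']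
    · obtain rfl : i = 0 := by omega
      exact hγ.mono fun r hr => Ioo_subset_Icc_self (hball r (hsub r (by simpa using hr))).1
  have hle : finslerDist F (γ s) (γ u) ≤ finslerLength F γ s u :=
    iInf_le_of_le γ <| iInf_le_of_le s <| iInf_le_of_le u <| iInf_le_of_le hcurve le_rfl
  refine hle.trans ((setLIntegral_mono' measurableSet_Icc fun r hr =>
    ENNReal.ofReal_le_ofReal (hball r (hsub r hr)).2.le).trans ?_)
  rw [setLIntegral_const, Real.volume_Icc]

/-- At an interior point of smoothness, the local dilatation with respect to the symmetrized distance
of a Finsler function is the symmetrization of the Finsler function on the velocity. -/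
theorem localDilatation_symmetrizedDist [FiniteDimensional ℝ E] [T2Space M]
    (hF : IsFinslerFunction F) (hF' : IsFinslerFunction (reverseNorm F))
    {γ : ℝ → M} {a b t : ℝ} (hγ : ContMDiffOn 𝓘(ℝ, ℝ) 𝓘(ℝ, E) ∞ γ (Icc a b)) (ht : t ∈ Ioo a b)
    {S : Set ℝ} (hS : Icc a b ⊆ S) :
    localDilatation (symmetrizedDist (finslerDist F)) γ S t =
      ENNReal.ofReal ((F (γ t) (mfderiv 𝓘(ℝ, ℝ) 𝓘(ℝ, E) γ t (1 : ℝ)) +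
        reverseNorm F (γ t) (mfderiv 𝓘(ℝ, ℝ) 𝓘(ℝ, E) γ t (1 : ℝ))) / 2) := by
  set A := F (γ t) (mfderiv 𝓘(ℝ, ℝ) 𝓘(ℝ, E) γ t (1 : ℝ)) with hA
  set B := reverseNorm F (γ t) (mfderiv 𝓘(ℝ, ℝ) 𝓘(ℝ, E) γ t (1 : ℝ)) with hB
  have hA0 : 0 ≤ A := hF.nonneg _ _
  have hB0 : 0 ≤ B := hF'.nonneg _ _
  have hlim : ∀ σ : ℝ, Tendsto (fun η : ℝ => ENNReal.ofReal ((A + B) / 2 + σ * η)) (𝓝[>] 0)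
      (𝓝 (ENNReal.ofReal ((A + B) / 2))) := fun σ => by
    have h1 : Continuous fun η : ℝ => ENNReal.ofReal ((A + B) / 2 + σ * η) :=
      ENNReal.continuous_ofReal.comp (by fun_prop)
    simpa using (h1.tendsto 0).mono_left nhdsWithin_le_nhds
  apply le_antisymm
  · refine ge_of_tendsto (hlim 1) ?_
    filter_upwards [self_mem_nhdsWithin] with η hη
    have hη' : (0 : ℝ) < η := hη
    obtain ⟨ε₁, hε₁, h₁⟩ := exists_finslerDist_le hF.continuous hγ ht (lt_add_of_pos_right A hη')
    obtain ⟨ε₂, hε₂, h₂⟩ := exists_finslerDist_le hF'.continuous hγ ht (lt_add_of_pos_right B hη')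
    simp only [finslerDist_reverseNorm] at h₂
    have hpair : ∀ s ∈ Ioo (t - min ε₁ ε₂) (t + min ε₁ ε₂),
        ∀ u ∈ Ioo (t - min ε₁ ε₂) (t + min ε₁ ε₂), s < u →
        finslerDist F (γ s) (γ u) + finslerDist F (γ u) (γ s) ≤
          ENNReal.ofReal ((A + B) / 2 + 1 * η) * ENNReal.ofReal (u - s) * 2 := by
      intro s hs u hu hsu
      have hi₁ : Ioo (t - min ε₁ ε₂) (t + min ε₁ ε₂) ⊆ Ioo (t - ε₁) (t + ε₁) :=
        Ioo_subset_Ioo (by linarith [min_le_left ε₁ ε₂]) (by linarith [min_le_left ε₁ ε₂])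
      have hi₂ : Ioo (t - min ε₁ ε₂) (t + min ε₁ ε₂) ⊆ Ioo (t - ε₂) (t + ε₂) :=
        Ioo_subset_Ioo (by linarith [min_le_right ε₁ ε₂]) (by linarith [min_le_right ε₁ ε₂])
      refine (add_le_add (h₁ s (hi₁ hs) u (hi₁ hu) hsu) (h₂ s (hi₂ hs) u (hi₂ hu) hsu)).trans
        (le_of_eq ?_)
      rw [← add_mul, ← ENNReal.ofReal_add (by positivity) (by positivity), mul_right_comm,
        ← ENNReal.ofReal_ofNat 2, ← ENNReal.ofReal_mul (p := (A + B) / 2 + 1 * η) (by positivity)]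
      congr 2
      ring
    refine iInf₂_le_of_le (min ε₁ ε₂) (lt_min hε₁ hε₂) ?_
    refine iSup₂_le fun s hs => iSup₂_le fun u hu => iSup_le fun hsu => ?_
    refine ENNReal.div_le_of_le_mul (ENNReal.div_le_of_le_mul ?_)
    rcases hsu.lt_or_gt with h0 | h0
    · rw [abs_sub_comm, abs_of_pos (sub_pos.mpr h0)]
      exact hpair s hs.2 u hu.2 h0
    · rw [abs_of_pos (sub_pos.mpr h0), add_comm]
      exact hpair u hu.2 s hs.2 h0
  · refine le_of_tendsto (hlim (-1)) ?_
    filter_upwards [self_mem_nhdsWithin] with η hη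
    have hη' : (0 : ℝ) < η := hη
    have hd : MDifferentiableAt 𝓘(ℝ, ℝ) 𝓘(ℝ, E) γ t :=
      (hγ.contMDiffAt (Icc_mem_nhds ht.1 ht.2)).mdifferentiableAt (by simp)
    have h₁ := hF.eventually_le_finslerDist hd (sub_lt_self A hη')
    have h₂ := hF'.eventually_le_finslerDist hd (sub_lt_self B hη')
    simp only [finslerDist_reverseNorm] at h₂
    refine le_iInf₂ fun ε hε => ?_
    have h₃ : ∀ᶠ u in 𝓝[>] t, u ∈ Ioo a b ∩ Ioo (t - ε) (t + ε) :=
      nhdsWithin_le_nhds ((isOpen_Ioo.inter isOpen_Ioo).mem_nhds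
        ⟨ht, by linarith, by linarith⟩)
    obtain ⟨u, ⟨⟨hu₁, hu₂⟩, hu₃⟩, hu₄⟩ :=
      (((h₁.and h₂).and h₃).and self_mem_nhdsWithin).exists
    have hut : 0 < u - t := sub_pos.mpr hu₄
    refine le_iSup₂_of_le t ⟨hS (Ioo_subset_Icc_self ht), by linarith, by linarith⟩ <|
      le_iSup₂_of_le u ⟨hS (Ioo_subset_Icc_self hu₃.1), hu₃.2⟩ <|
      le_iSup_of_le (ne_of_lt hu₄) ?_
    rw [abs_sub_comm, abs_of_pos hut, symmetrizedDist,
      ENNReal.le_div_iff_mul_le (Or.inl (by simpa using hu₄)) (Or.inl ENNReal.ofReal_ne_top),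
      ENNReal.le_div_iff_mul_le (Or.inl two_ne_zero) (Or.inl ENNReal.ofNat_ne_top)]
    refine le_trans (le_of_eq ?_) (ENNReal.ofReal_add_le.trans (add_le_add hu₁ hu₂))
    rw [← ENNReal.ofReal_mul' hut.le, ← ENNReal.ofReal_ofNat 2, ← ENNReal.ofReal_mul' (by simp)]
    congr 1
    ring

theorem exists_mem_Ioo_of_forall_ne {t : ℕ → ℝ} {x : ℝ} {n : ℕ} (h0 : t 0 ≤ x) (hn : x ≤ t n)
    (hne : ∀ i ≤ n, x ≠ t i) : ∃ i < n, x ∈ Ioo (t i) (t (i + 1)) := by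
  induction n with
  | zero => exact absurd (le_antisymm hn h0) (hne 0 le_rfl)
  | succ n ih =>
    rcases le_or_gt x (t n) with h | h
    · obtain ⟨i, hi, hx⟩ := ih h fun i hi => hne i (by omega)
      exact ⟨i, by omega, hx⟩
    · exact ⟨n, by omega, h, hn.lt_of_ne (hne _ le_rfl)⟩

/-- For a piecewise smooth curve, the length with respect to the symmetrized Randers distance is the
Riemannian length: the contributions of the `1`-form in the two directions cancel. -/
theorem IsRandersForm.dilatationLength_eq [FiniteDimensional ℝ E] [T2Space M]
    {h : ContMDiffRiemannianMetric 𝓘(ℝ, E) ∞ E (fun x : M => TangentSpace 𝓘(ℝ, E) x)}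
    {θ : ∀ x : M, TangentSpace 𝓘(ℝ, E) x →L[ℝ] ℝ} (hθ : IsRandersForm h θ) {γ : ℝ → M} {a b : ℝ}
    (hγ : PiecewiseSmoothOn E γ a b) :
    dilatationLength (symmetrizedDist (finslerDist (randersNorm h θ))) γ a b =
      finslerLength (riemannianNorm h) γ a b := by
  obtain ⟨n, t, ht, rfl, rfl, hs⟩ := hγ
  have hae : ∀ᵐ x : ℝ, x ∉ t '' Iic n :=
    measure_eq_zero_iff_ae_notMem.mp (((finite_Iic n).image t).measure_zero volume)
  refine setLIntegral_congr_fun_ae measurableSet_Icc ?_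
  filter_upwards [hae] with x hx hxI
  obtain ⟨i, hi, hxi⟩ := exists_mem_Ioo_of_forall_ne hxI.1 hxI.2
    fun i hi h0 => hx ⟨i, hi, h0.symm⟩
  rw [localDilatation_symmetrizedDist hθ.isFinslerFunction hθ.isFinslerFunction_reverseNorm
    (hs i hi) hxi (Icc_subset_Icc (ht (Nat.zero_le i)) (ht (by omega)))]
  congr 1
  simp only [reverseNorm_randersNorm, randersNorm, riemannianNorm, _root_.neg_apply]
  ring

end Dilatation

theorem proposition6p1 {E : Type*} [NormedAddCommGroup E] [NormedSpace ℝ E]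
    [FiniteDimensional ℝ E]
    {M : Type*} [TopologicalSpace M] [T2Space M] [SecondCountableTopology M] [ConnectedSpace M]
    [ChartedSpace E M] [IsManifold 𝓘(ℝ, E) ∞ M]
    (h : ContMDiffRiemannianMetric 𝓘(ℝ, E) ∞ E (fun x : M => TangentSpace 𝓘(ℝ, E) x))
    (θ : ∀ x : M, TangentSpace 𝓘(ℝ, E) x →L[ℝ] ℝ) (hθ : IsRandersForm h θ) (p q : M) :
    lengthDist E (symmetrizedDist (finslerDist (randersNorm h θ))) p q =
      finslerDist (riemannianNorm h) p q :=
  iInf_congr fun _ => iInf_congr fun _ => iInf_congr fun _ => iInf_congr fun hγ =>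
    hθ.dilatationLength_eq hγ.smooth
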